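/- Theorem 5.1. Let $k$ be a field and $n\ge 1$. For a finite set $A=\{\mathbf a_1,\dots,\mathbf a_p\}\subset\mathbb N^n\setminus\{0\}$ (where $0\in\mathbb N$), also denote by $A$ the $n\times p$ matrix with columns $\mathbf a_1,\dots,\mathbf a_p$, let $I_A$ be the kernel of the $k$-algebra homomorphism $k[x_1,\dots,x_p]\to k[t_1,\dots,t_n]$, $x_j\mapsto t^{\mathbf a_j}$, and let $k[A]=k[x_1,\dots,x_p]/I_A$ be the semigroup ring. Let $B=\{\mathbf b_1,\dots,\mathbf b_q\}\subset\mathbb N^n\setminus\{0\}$ be another finite set, with variables $y_1,\dots,y_q$. For integers $k_1,k_2\ge 1$ and $C=k_1A\cup k_2B$, let $I_C$ be the kernel of $k[x_1,\dots,x_p,y_1,\dots,y_q]\to k[t_1,\dots,t_n]$, $x_i\mapsto t^{k_1\mathbf a_i}$, $y_j\mapsto t^{k_2\mathbf b_j}$, and $k[C]=k[x_1,\dots,x_p,y_1,\dots,y_q]/I_C$. We say that $\langle C\rangle$ is a gluing of $\langle A\rangle$ and $\langle B\rangle$ if $I_C=I_A+I_B+\langle\rho\rangle$, as ideals of $k[x_1,\dots,x_p,y_1,\dots,y_q]$,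 for some nonzero binomial $\rho=x^\alpha-y^\beta$ with $\alpha\in\mathbb N^p$, $\beta\in\mathbb N^q$; and that $\langle A\rangle$ and $\langle B\rangle$ can be glued if this happens for some integers $k_1,k_2\ge 1$. Let $A$ and $B$ be two finite subsets of $\mathbb N^2\setminus\{0\}$ such that $k[A]$ and $k[B]$ are Cohen–Macaulay. Then $\langle A\rangle$ and $\langle B\rangle$ can be glued if and only if, possibly after exchanging $A$ and $B$, there is a vector $\mathbf b\in\mathbb N^2$ such that (1) either $B=\{\mathbf b\}$, or $q\ge 2$ and $B=\mathbf b\,[u_1\ \dots\ u_q]$ (that is, $\mathbf b_j=u_j\mathbf b$ for all $j$) for some $u_1,\dots,u_q\in\mathbb N$; and (2) the system $A\cdot X=d\,\mathbf b$ has a solution $X\in\mathbb N^p$ for some integer $d\ge 1$. Moreover, whenever $\langle C\rangle$ with $C=k_1A\cup k_2B$, $k_1,k_2\ge 1$, is a gluing of $\langle A\rangle$ and $\langle B\rangle$, the ring $k[C]$ is Cohen–Macaulay. -/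

import Mathlib

/-- A Noetherian local ring is Cohen–Macaulay if its depth equals its Krull dimension. The depth is
the largest length of a regular sequence in the maximal ideal and is never larger than the
dimension, so this says that some regular sequence in the maximal ideal has length `dim R`. -/
structure IsCohenMacaulayLocal (R : Type*) [CommRing R] [IsLocalRing R] : Prop where
  isNoetherian : IsNoetherianRing R
  exists_regular : ∃ rs : List R, (∀ r ∈ rs, r ∈ IsLocalRing.maximalIdeal R) ∧
    RingTheory.Sequence.IsRegular R rs ∧ ((rs.length : ℕ∞) : WithBot ℕ∞) = ringKrullDim R

/-- A Noetherian ring is Cohen–Macaulay if its localizations at all maximal ideals are. -/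
structure IsCohenMacaulay (R : Type*) [CommRing R] : Prop where
  isNoetherian : IsNoetherianRing R
  localization : ∀ (m : Ideal R) [m.IsMaximal], IsCohenMacaulayLocal (Localization.AtPrime m)

namespace AffineSemigroup

open MvPolynomial

variable (k : Type*) [Field k] {n : ℕ} {ι κ : Type*}

/-- For vectors `a j ∈ ℕⁿ`, the homomorphism `φ : k[x_j] → k[t₁, …, tₙ]`, `x_j ↦ t ^ (a j)`. -/
noncomputable def monomialHom (a : ι → Fin n → ℕ) :
    MvPolynomial ι k →ₐ[k] MvPolynomial (Fin n) k :=
  aeval fun j => ∏ i, X i ^ a j i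

/-- The defining ideal `I_A = ker φ`. -/
noncomputable def definingIdeal (a : ι → Fin n → ℕ) : Ideal (MvPolynomial ι k) :=
  RingHom.ker (monomialHom k a)

/-- The semigroup ring `k[A] ≅ k[x_j] / I_A`. -/
abbrev semigroupRing (a : ι → Fin n → ℕ) : Type _ :=
  MvPolynomial ι k ⧸ definingIdeal k a

/-- The generators of `C = k₁ A ∪ k₂ B`. The variables of `k[C]` attached to `A` are indexed by
`Sum.inl` and the ones attached to `B` by `Sum.inr`. -/
def union (k₁ k₂ : ℕ) (a : ι → Fin n → ℕ) (b : κ → Fin n → ℕ) : ι ⊕ κ → Fin n → ℕ :=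
  Sum.elim (fun i => k₁ • a i) (fun j => k₂ • b j)

/-- The difference `x ^ α - y ^ β` of a monomial in the variables of `A` and a monomial in the
variables of `B`. -/
noncomputable def binomial [Fintype ι] [Fintype κ] (α : ι → ℕ) (β : κ → ℕ) :
    MvPolynomial (ι ⊕ κ) k :=
  ∏ i, X (Sum.inl i) ^ α i - ∏ j, X (Sum.inr j) ^ β j

/-- For `C = k₁ A ∪ k₂ B`, the semigroup `⟨C⟩` is a gluing of `⟨A⟩` and `⟨B⟩`:
`I_C = I_A + I_B + ⟨ρ⟩` for a (nonzero) binomial `ρ = x ^ α - y ^ β`. -/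
def IsGluing [Fintype ι] [Fintype κ] (k₁ k₂ : ℕ)
    (a : ι → Fin n → ℕ) (b : κ → Fin n → ℕ) : Prop :=
  ∃ (α : ι → ℕ) (β : κ → ℕ), binomial k α β ≠ 0 ∧
    definingIdeal k (union k₁ k₂ a b) =
      (definingIdeal k a).map (rename (R := k) (Sum.inl : ι → ι ⊕ κ)) ⊔
      (definingIdeal k b).map (rename (R := k) (Sum.inr : κ → ι ⊕ κ)) ⊔
      Ideal.span {binomial k α β}

/-- `⟨A⟩` and `⟨B⟩` can be glued. -/
def CanBeGlued [Fintype ι] [Fintype κ] (a : ι → Fin n → ℕ) (b : κ → Fin n → ℕ) : Prop :=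
  ∃ k₁ k₂ : ℕ, 0 < k₁ ∧ 0 < k₂ ∧ IsGluing k k₁ k₂ a b

/-- The finite set `A`, viewed as the family of its elements (the columns of its matrix). -/
def columns (A : Finset (Fin n → ℕ)) : A → Fin n → ℕ := fun a => a.1

/-- Either `B = {b}`, or `B` has at least two elements and they lie on a line, `B = b·[u₁ … u_q]`. -/
def IsPointOrLine (B : Finset (Fin n → ℕ)) (b : Fin n → ℕ) : Prop :=
  B = {b} ∨ (2 ≤ B.card ∧ ∃ u : B → ℕ, ∀ c : B, columns B c = u c • b)

/-- The system `A·X = d·b` has a solution `X` in natural numbers for some `d ≥ 1`. -/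
def HasMultipleIn (A : Finset (Fin n → ℕ)) (b : Fin n → ℕ) : Prop :=
  ∃ d : ℕ, 0 < d ∧ ∃ X : A → ℕ, ∑ a : A, X a • columns A a = d • b

end AffineSemigroup

/-! A defining ideal is spanned by differences of monomials of equal degree. If `x ^ α - y ^ β`
glues, then every vector of the lattice `k₁ ℤA ∩ k₂ ℤB` is an integer multiple of `k₁ • degree a α`
(`exists_int_of_gluing_of_int`). Were `A` and `B` both to span the plane, this lattice would have
rank 2; so one of them is collinear (`det_eq_zero_of_gluing`), and `k₁ • degree a α = k₂ • degree b
β` puts a positive multiple of its direction in the other semigroup.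

Conversely, suppose `B` lies on a line and `⟨A⟩` meets that line away from 0. A choice of `k₁`,
`k₂`, `α`, `β` governed by a coprimality condition makes any coincidence of degrees in `C` an
exchange of copies of `x ^ α` for copies of `y ^ β` (`exists_isBalanced_of_line`,
`IsBalanced.isGluing`).

For the Cohen–Macaulay property, `k[C]` is `k[A] ⊗ k[B]` over `k[z]`, with `z` acting as `x ^ α` and
`y ^ β`. The collinear factor is finite and torsion-free over the principal ideal domain `k[z]`,
hence flat. By base change `k[C]` is finite and flat over the other factor, and the Cohen–Macaulay
property ascends along such extensions (`IsCohenMacaulay.of_finite_flat`). -/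

/-! ### Ascent of the Cohen–Macaulay property along finite flat maps. -/

/-- Integrality makes contraction strictly monotone on primes, which gives `≤`; flatness gives
going-down, hence `≥`. -/
lemma Ideal.height_eq_height_under_of_finite_flat (R : Type*) {S : Type*} [CommRing R] [CommRing S]
    [Algebra R S] [IsNoetherianRing R] [IsNoetherianRing S] [Module.Flat R S]
    [Algebra.IsIntegral R S]
    (P : Ideal S) [P.IsPrime] : P.height = (P.under R).height := by
  apply le_antisymm
  · rw [(⟨P, ‹_›⟩ : PrimeSpectrum S).height_eq_orderHeight,
      (⟨P.under R, inferInstance⟩ : PrimeSpectrum R).height_eq_orderHeight]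
    have hmono : StrictMono (PrimeSpectrum.comap (algebraMap R S)) := by
      intro p q hpq
      exact Ideal.IsIntegral.comap_lt_comap (R := R) (I := p.asIdeal) (J := q.asIdeal) hpq
    exact Order.height_le_height_apply_of_strictMono _ hmono ⟨P, inferInstance⟩
  · rw [Ideal.height_eq_height_add_of_liesOver_of_hasGoingDown (P.under R) P]
    exact le_self_add

/-- The localized map is flat and local, hence faithfully flat, so a regular sequence downstairs
stays regular; its length is still the dimension because heights agree. -/
theorem IsCohenMacaulay.of_finite_flat {R S : Type*} [CommRing R] [CommRing S] [Algebra R S]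
    [Module.Finite R S] [Module.Flat R S] (h : IsCohenMacaulay R) : IsCohenMacaulay S := by
  have := h.isNoetherian
  have : IsNoetherianRing S := IsNoetherianRing.of_finite R S
  refine ⟨this, fun P hP => ?_⟩
  have hm : (P.under R).IsMaximal := Ideal.isMaximal_comap_of_isIntegral_of_isMaximal P
  obtain ⟨-, rs, hmem, hreg, hlen⟩ := h.localization (P.under R)
  refine ⟨inferInstance, ?_⟩
  have hflat : (algebraMap R S).Flat := RingHom.flat_algebraMap_iff.2 inferInstance
  let f := Localization.localRingHom (P.under R) P (algebraMap R S) rfl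
  have hf : f.Flat := RingHom.Flat.localRingHom hflat P (P.under R) rfl
  have hloc : IsLocalHom f := Localization.isLocalHom_localRingHom _ _ _ _
  let := f.toAlgebra
  have : Module.Flat (Localization.AtPrime (P.under R)) (Localization.AtPrime P) := hf
  have : IsLocalHom (algebraMap (Localization.AtPrime (P.under R)) (Localization.AtPrime P)) := hloc
  have := Module.FaithfullyFlat.of_flat_of_isLocalHom (A := Localization.AtPrime (P.under R))
    (B := Localization.AtPrime P)
  refine ⟨rs.map (algebraMap _ _), ?_, hreg.of_faithfullyFlat, ?_⟩
  · intro r hr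
    obtain ⟨s, hs, rfl⟩ := List.mem_map.1 hr
    exact IsLocalRing.map_maximalIdeal_le f (Ideal.mem_map_of_mem _ (hmem s hs))
  · rw [List.length_map, hlen, IsLocalization.AtPrime.ringKrullDim_eq_height (P.under R),
      IsLocalization.AtPrime.ringKrullDim_eq_height P,
      Ideal.height_eq_height_under_of_finite_flat R P]

theorem IsCohenMacaulay.of_ringEquiv {R S : Type*} [CommRing R] [CommRing S] (e : R ≃+* S)
    (h : IsCohenMacaulay R) : IsCohenMacaulay S := by
  let := e.toRingHom.toAlgebra
  have : Module.Flat R S := RingHom.Flat.of_bijective (f := e.toRingHom) e.bijective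
  have : Module.Finite R S := RingHom.Finite.of_surjective e.toRingHom e.surjective
  exact h.of_finite_flat

namespace AffineSemigroup

open MvPolynomial

/-! ### Degrees of monomials and binomials in the defining ideal. -/

section Degree

variable {n : ℕ} {ι κ : Type*} [Fintype ι] [Fintype κ]

/-- The degree `∑ pᵢ aᵢ` of the monomial `x ^ p`. -/
def degree (a : ι → Fin n → ℕ) (p : ι → ℕ) : Fin n → ℕ := ∑ i, p i • a i

lemma degree_add (a : ι → Fin n → ℕ) (p q : ι → ℕ) :
    degree a (p + q) = degree a p + degree a q := by
  simp [degree, add_smul, Finset.sum_add_distrib]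

lemma degree_smul (a : ι → Fin n → ℕ) (m : ℕ) (p : ι → ℕ) :
    degree a (m • p) = m • degree a p := by
  simp [degree, Finset.smul_sum, mul_smul]

lemma degree_single [DecidableEq ι] (a : ι → Fin n → ℕ) (i : ι) (m : ℕ) :
    degree a (Pi.single i m) = m • a i := by
  rw [degree, Finset.sum_eq_single i] <;> simp +contextual

lemma degree_apply (a : ι → Fin n → ℕ) (p : ι → ℕ) (l : Fin n) :
    degree a p l = ∑ i, p i * a i l := by
  simp [degree]

@[simp]
lemma degree_zero (a : ι → Fin n → ℕ) : degree a 0 = 0 := by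
  simp [degree]

lemma degree_union (k₁ k₂ : ℕ) (a : ι → Fin n → ℕ) (b : κ → Fin n → ℕ) (r : ι ⊕ κ → ℕ) :
    degree (union k₁ k₂ a b) r =
      k₁ • degree a (fun i => r (.inl i)) + k₂ • degree b (fun j => r (.inr j)) := by
  simp only [degree, union, Fintype.sum_sum_type, Sum.elim_inl, Sum.elim_inr, Finset.smul_sum]
  congr 1 <;> exact Finset.sum_congr rfl fun _ _ => smul_comm ..

lemma degree_eq_zero {a : ι → Fin n → ℕ} (ha : ∀ i, a i ≠ 0) {p : ι → ℕ} (h : degree a p = 0) :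
    p = 0 := by
  ext i
  by_contra hp
  refine ha i (funext fun l => ?_)
  have := congrFun h l
  rw [degree_apply, Pi.zero_apply, Finset.sum_eq_zero_iff] at this
  exact (mul_eq_zero.1 (this i (Finset.mem_univ i))).resolve_left hp

end Degree

section Kernel

variable {k : Type*} [Field k] {n : ℕ} {ι κ : Type*} [Fintype ι] [Fintype κ]

lemma monomial_eq_smul_prod (p : ι →₀ ℕ) (c : k) :
    monomial p c = c • ∏ i, X (R := k) i ^ p i := by
  rw [monomial_eq, Finsupp.prod_fintype _ _ (by simp), C_mul']

lemma monomialHom_prod (a : ι → Fin n → ℕ) (p : ι → ℕ) :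
    monomialHom k a (∏ i, X i ^ p i) = ∏ l, X l ^ degree a p l := by
  simp only [monomialHom, map_prod, map_pow, aeval_X, degree_apply, ← Finset.prod_pow, ← pow_mul]
  rw [Finset.prod_comm]
  refine Finset.prod_congr rfl fun l _ => ?_
  rw [Finset.prod_pow_eq_pow_sum]
  simp only [mul_comm]

lemma prod_X_pow_injective :
    Function.Injective fun p : ι → ℕ => ∏ i, X (R := k) i ^ p i := by
  intro p q h
  have key (p : ι → ℕ) : ∏ i, X (R := k) i ^ p i = monomial (Finsupp.equivFunOnFinite.symm p) 1 := by
    simp [monomial_eq_smul_prod]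
  simp only [key] at h
  exact Finsupp.equivFunOnFinite.symm.injective (monomial_left_injective one_ne_zero h)

lemma prod_sub_prod_mem_definingIdeal {a : ι → Fin n → ℕ} {p q : ι → ℕ} :
    ∏ i, X i ^ p i - ∏ i, X i ^ q i ∈ definingIdeal k a ↔ degree a p = degree a q := by
  rw [definingIdeal, RingHom.mem_ker, map_sub, sub_eq_zero, monomialHom_prod, monomialHom_prod]
  exact prod_X_pow_injective.eq_iff

/-- The defining ideal is spanned by binomials, in the form of a universal property. -/
lemma eq_zero_of_mem_definingIdeal {V : Type*} [AddCommGroup V] [Module k V]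
    {a : ι → Fin n → ℕ} (g : MvPolynomial ι k →ₗ[k] V)
    (hg : ∀ p q : ι → ℕ, degree a p = degree a q → g (∏ i, X i ^ p i) = g (∏ i, X i ^ q i))
    {f : MvPolynomial ι k} (hf : f ∈ definingIdeal k a) : g f = 0 := by
  classical
  -- `L` factors `g` through the monomial map. On `t ^ s` it uses any exponent of degree `s`, the
  -- choice being harmless by `hg`; the value 0 for other `s` plays no role on the image.
  let L : MvPolynomial (Fin n) k →ₗ[k] V := (basisMonomials (Fin n) k).constr k fun s =>
    if h : ∃ p : ι → ℕ, degree a p = s then g (∏ i, X i ^ h.choose i) else 0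
  have hL : L ∘ₗ (monomialHom k a).toLinearMap = g := by
    refine (basisMonomials ι k).ext fun p => ?_
    have hp : basisMonomials ι k p = ∏ i, X i ^ p i := by
      simp [monomial_eq_smul_prod]
    have hs : ∏ l, X (R := k) l ^ degree a p l =
        basisMonomials (Fin n) k (Finsupp.equivFunOnFinite.symm (degree a p)) := by
      simp [monomial_eq_smul_prod]
    have hex : ∃ q : ι → ℕ, degree a q = Finsupp.equivFunOnFinite.symm (degree a p) := ⟨p, rfl⟩
    rw [hp, LinearMap.comp_apply, AlgHom.toLinearMap_apply, monomialHom_prod, hs,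
      Module.Basis.constr_basis, dif_pos hex]
    exact hg _ _ hex.choose_spec
  rw [← hL, LinearMap.comp_apply, AlgHom.toLinearMap_apply, RingHom.mem_ker.1 hf, map_zero]

lemma definingIdeal_le {a : ι → Fin n → ℕ} {J : Ideal (MvPolynomial ι k)}
    (hJ : ∀ p q : ι → ℕ, degree a p = degree a q → ∏ i, X i ^ p i - ∏ i, X i ^ q i ∈ J) :
    definingIdeal k a ≤ J := fun _ hf =>
  Ideal.Quotient.eq_zero_iff_mem.1 <| eq_zero_of_mem_definingIdeal
    (Ideal.Quotient.mkₐ k J).toLinearMap (fun p q h => Ideal.Quotient.eq.2 (hJ p q h)) hf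

instance (a : ι → Fin n → ℕ) : (definingIdeal k a).IsPrime := RingHom.ker_isPrime _

lemma binomial_eq (α : ι → ℕ) (β : κ → ℕ) : binomial k α β =
    ∏ s, X s ^ (Sum.elim α (0 : κ → ℕ)) s - ∏ s, X s ^ (Sum.elim (0 : ι → ℕ) β) s := by
  simp [binomial, Fintype.prod_sum_type]

end Kernel

/-! ### Gluings in terms of degrees. -/

section Gluing

variable {k : Type*} [Field k] {n : ℕ} {ι κ : Type*} [Fintype ι] [Fintype κ]

lemma rename_inl_prod (p : ι → ℕ) : rename (R := k) (Sum.inl : ι → ι ⊕ κ) (∏ i, X i ^ p i) =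
    ∏ s, X s ^ (Sum.elim p (0 : κ → ℕ)) s := by
  simp [Fintype.prod_sum_type]

lemma rename_inr_prod (p : κ → ℕ) : rename (R := k) (Sum.inr : κ → ι ⊕ κ) (∏ i, X i ^ p i) =
    ∏ s, X s ^ (Sum.elim (0 : ι → ℕ) p) s := by
  simp [Fintype.prod_sum_type]

lemma binomial_ne_zero_iff {α : ι → ℕ} {β : κ → ℕ} : binomial k α β ≠ 0 ↔ α ≠ 0 ∨ β ≠ 0 := by
  rw [binomial_eq, Ne, sub_eq_zero, prod_X_pow_injective.eq_iff]
  simp only [funext_iff, Sum.forall, Sum.elim_inl, Sum.elim_inr, Pi.zero_apply, ne_eq, eq_comm]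
  tauto

lemma binomial_mem_definingIdeal_union {k₁ k₂ : ℕ} {a : ι → Fin n → ℕ} {b : κ → Fin n → ℕ}
    {α : ι → ℕ} {β : κ → ℕ} : binomial k α β ∈ definingIdeal k (union k₁ k₂ a b) ↔
      k₁ • degree a α = k₂ • degree b β := by
  have h0 : degree a (fun _ => 0) = 0 := degree_zero a
  have h0' : degree b (fun _ => 0) = 0 := degree_zero b
  rw [binomial_eq, prod_sub_prod_mem_definingIdeal, degree_union, degree_union]
  simp [h0, h0']

/-- Grade the variables by `ℤⁿ × ℤⁿ` modulo the class of `(degree a α, -degree b β)`. All generators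
of the right side of `hI` are homogeneous, so the two monomials of any binomial in `I_C` have the
same class. The grading is encoded as a homomorphism to the group algebra of the quotient. -/
lemma exists_int_of_gluing {k₁ k₂ : ℕ} {a : ι → Fin n → ℕ} {b : κ → Fin n → ℕ}
    {α : ι → ℕ} {β : κ → ℕ}
    (hI : definingIdeal k (union k₁ k₂ a b) =
      (definingIdeal k a).map (rename (R := k) (Sum.inl : ι → ι ⊕ κ)) ⊔
      (definingIdeal k b).map (rename (R := k) (Sum.inr : κ → ι ⊕ κ)) ⊔
      Ideal.span {binomial k α β})
    {r r' : ι ⊕ κ → ℕ} (h : degree (union k₁ k₂ a b) r = degree (union k₁ k₂ a b) r') :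
    ∃ m : ℤ, ∀ l, (degree a (fun i => r (.inl i)) l : ℤ) - degree a (fun i => r' (.inl i)) l =
      m * degree a α l := by
  let w (r : ι ⊕ κ → ℕ) : (Fin n → ℤ) × (Fin n → ℤ) := (fun l => (degree a (fun i => r (.inl i)) l : ℤ),
    fun l => (degree b (fun j => r (.inr j)) l : ℤ))
  let ρ : (Fin n → ℤ) × (Fin n → ℤ) := w (Sum.elim α 0) - w (Sum.elim 0 β)
  let G := ((Fin n → ℤ) × (Fin n → ℤ)) ⧸ AddSubgroup.zmultiples ρ
  let c : ι ⊕ κ → (Fin n → ℤ) × (Fin n → ℤ) :=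
    Sum.elim (fun i => (fun l => (a i l : ℤ), 0)) (fun j => (0, fun l => (b j l : ℤ)))
  let g : MvPolynomial (ι ⊕ κ) k →ₐ[k] AddMonoidAlgebra k G :=
    aeval fun s => AddMonoidAlgebra.of k G (Multiplicative.ofAdd (c s : G))
  have hw (r : ι ⊕ κ → ℕ) : w r = ∑ s, r s • c s := by
    rw [Fintype.sum_sum_type]
    ext l <;> simp [w, c, degree_apply, Prod.fst_sum, Prod.snd_sum]
  have hg (r : ι ⊕ κ → ℕ) : g (∏ s, X s ^ r s) =
      AddMonoidAlgebra.of k G (Multiplicative.ofAdd (w r : G)) := by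
    have : (w r : G) = ∑ s, r s • (c s : G) := by
      rw [hw]
      exact (map_sum (QuotientAddGroup.mk' (AddSubgroup.zmultiples ρ)) _ _).trans (by simp)
    simp only [g, map_prod, map_pow, aeval_X, this, ofAdd_sum, ofAdd_nsmul]
  have hker : definingIdeal k (union k₁ k₂ a b) ≤ RingHom.ker g := by
    rw [hI]
    refine sup_le (sup_le ?_ ?_) ?_
    · rw [Ideal.map_le_iff_le_comap]
      refine definingIdeal_le fun p q hpq => ?_
      rw [Ideal.mem_comap, map_sub, RingHom.mem_ker, map_sub, rename_inl_prod,
        rename_inl_prod, hg, hg, sub_eq_zero]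
      simp [w, hpq]
    · rw [Ideal.map_le_iff_le_comap]
      refine definingIdeal_le fun p q hpq => ?_
      rw [Ideal.mem_comap, map_sub, RingHom.mem_ker, map_sub, rename_inr_prod,
        rename_inr_prod, hg, hg, sub_eq_zero]
      simp [w, hpq]
    · rw [Ideal.span_singleton_le_iff_mem, RingHom.mem_ker, binomial_eq, map_sub, hg, hg,
        sub_eq_zero]
      congr 2
      exact (QuotientAddGroup.eq_iff_sub_mem).2 (AddSubgroup.mem_zmultiples ρ)
  have := hker (prod_sub_prod_mem_definingIdeal.2 h)
  rw [RingHom.mem_ker, map_sub, hg, hg, sub_eq_zero, (AddMonoidAlgebra.of_injective).eq_iff,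
    Multiplicative.ofAdd.injective.eq_iff, QuotientAddGroup.eq_iff_sub_mem,
    AddSubgroup.mem_zmultiples_iff] at this
  obtain ⟨m, hm⟩ := this
  refine ⟨m, fun l => ?_⟩
  have h0 : degree a (fun _ => 0) = 0 := degree_zero a
  simpa [ρ, w, h0, eq_comm] using congrArg (fun z : (Fin n → ℤ) × (Fin n → ℤ) => z.1 l) hm

lemma exists_int_of_gluing_of_int {k₁ k₂ : ℕ} {a : ι → Fin n → ℕ} {b : κ → Fin n → ℕ}
    {α : ι → ℕ} {β : κ → ℕ}
    (hI : definingIdeal k (union k₁ k₂ a b) =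
      (definingIdeal k a).map (rename (R := k) (Sum.inl : ι → ι ⊕ κ)) ⊔
      (definingIdeal k b).map (rename (R := k) (Sum.inr : κ → ι ⊕ κ)) ⊔
      Ideal.span {binomial k α β})
    (c : ι → ℤ) (c' : κ → ℤ) (h : ∀ l, k₁ * ∑ i, c i * a i l = k₂ * ∑ j, c' j * b j l) :
    ∃ m : ℤ, ∀ l, ∑ i, c i * a i l = m * degree a α l := by
  have hsub (z : ℤ) : z = z.toNat - (-z).toNat := by lia
  -- Exponents must be natural numbers: positive parts of `c` are grouped with negative parts of
  -- `c'`, and vice versa.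
  obtain ⟨m, hm⟩ := exists_int_of_gluing hI
    (r := Sum.elim (fun i => (c i).toNat) (fun j => (-c' j).toNat))
    (r' := Sum.elim (fun i => (-c i).toNat) (fun j => (c' j).toNat)) (by
      rw [degree_union, degree_union]
      ext l
      have := h l
      rw [Finset.sum_congr rfl fun i _ => congrArg (· * (a i l : ℤ)) (hsub (c i)),
        Finset.sum_congr rfl fun i _ => congrArg (· * (b i l : ℤ)) (hsub (c' i))] at this
      simp only [sub_mul, Finset.sum_sub_distrib] at this
      zify
      simp only [Sum.elim_inl, Sum.elim_inr, Pi.add_apply, Pi.smul_apply, degree_apply,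
        smul_eq_mul]
      push_cast
      linarith)
  refine ⟨m, fun l => ?_⟩
  rw [← hm l, Finset.sum_congr rfl fun i _ => congrArg (· * (a i l : ℤ)) (hsub (c i))]
  simp only [sub_mul, Finset.sum_sub_distrib, degree_apply, Sum.elim_inl, Nat.cast_sum, Nat.cast_mul]

/-- The numerical condition on `k₁ A`, `k₂ B` and the exponents `α`, `β` under which
`x ^ α - y ^ β` glues `⟨A⟩` and `⟨B⟩`. -/
structure IsBalanced (k₁ k₂ : ℕ) (a : ι → Fin n → ℕ) (b : κ → Fin n → ℕ) (α : ι → ℕ)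
    (β : κ → ℕ) : Prop where
  smul_degree : k₁ • degree a α = k₂ • degree b β
  exists_nat : ∀ (p p' : ι → ℕ) (q q' : κ → ℕ),
    k₁ • degree a p + k₂ • degree b q = k₁ • degree a p' + k₂ • degree b q' →
    ∃ m : ℕ, (degree a p = degree a p' + m • degree a α ∧
        degree b q' = degree b q + m • degree b β) ∨
      (degree a p' = degree a p + m • degree a α ∧ degree b q = degree b q' + m • degree b β)

lemma IsBalanced.symm {k₁ k₂ : ℕ} {a : ι → Fin n → ℕ} {b : κ → Fin n → ℕ} {α : ι → ℕ}
    {β : κ → ℕ} (h : IsBalanced k₁ k₂ a b α β) : IsBalanced k₂ k₁ b a β α where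
  smul_degree := h.smul_degree.symm
  exists_nat q q' p p' hpq := by
    obtain ⟨m, hm⟩ := h.exists_nat p p' q q' (by rw [add_comm, hpq, add_comm])
    exact ⟨m, by tauto⟩

lemma map_rename_inl_le_definingIdeal_union (k₁ k₂ : ℕ) (a : ι → Fin n → ℕ) (b : κ → Fin n → ℕ) :
    (definingIdeal k a).map (rename (R := k) (Sum.inl : ι → ι ⊕ κ)) ≤
      definingIdeal k (union k₁ k₂ a b) := by
  rw [Ideal.map_le_iff_le_comap]
  refine definingIdeal_le fun p q hpq => ?_
  rw [Ideal.mem_comap, map_sub, rename_inl_prod, rename_inl_prod,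
    prod_sub_prod_mem_definingIdeal, degree_union, degree_union]
  simp [hpq]

lemma map_rename_inr_le_definingIdeal_union (k₁ k₂ : ℕ) (a : ι → Fin n → ℕ) (b : κ → Fin n → ℕ) :
    (definingIdeal k b).map (rename (R := k) (Sum.inr : κ → ι ⊕ κ)) ≤
      definingIdeal k (union k₁ k₂ a b) := by
  rw [Ideal.map_le_iff_le_comap]
  refine definingIdeal_le fun p q hpq => ?_
  rw [Ideal.mem_comap, map_sub, rename_inr_prod, rename_inr_prod,
    prod_sub_prod_mem_definingIdeal, degree_union, degree_union]
  simp [hpq]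

lemma IsBalanced.isGluing {k₁ k₂ : ℕ} {a : ι → Fin n → ℕ} {b : κ → Fin n → ℕ} {α : ι → ℕ}
    {β : κ → ℕ} (h : IsBalanced k₁ k₂ a b α β) (h0 : α ≠ 0 ∨ β ≠ 0) : IsGluing k k₁ k₂ a b := by
  refine ⟨α, β, binomial_ne_zero_iff.2 h0, le_antisymm ?_ ?_⟩
  · set J := (definingIdeal k a).map (rename (R := k) (Sum.inl : ι → ι ⊕ κ)) ⊔
      (definingIdeal k b).map (rename (R := k) (Sum.inr : κ → ι ⊕ κ)) ⊔
      Ideal.span {binomial k α β} with hJ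
    let x (p : ι → ℕ) : MvPolynomial (ι ⊕ κ) k ⧸ J := Ideal.Quotient.mk J (∏ i, X (Sum.inl i) ^ p i)
    let y (q : κ → ℕ) : MvPolynomial (ι ⊕ κ) k ⧸ J := Ideal.Quotient.mk J (∏ i, X (Sum.inr i) ^ q i)
    have hx (p p' : ι → ℕ) (hp : degree a p = degree a p') : x p = x p' := by
      rw [← prod_sub_prod_mem_definingIdeal (k := k)] at hp
      refine Ideal.Quotient.eq.2 (Ideal.mem_sup_left (Ideal.mem_sup_left ?_))
      simpa using Ideal.mem_map_of_mem (rename (R := k) (Sum.inl : ι → ι ⊕ κ)) hp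
    have hy (p p' : κ → ℕ) (hp : degree b p = degree b p') : y p = y p' := by
      rw [← prod_sub_prod_mem_definingIdeal (k := k)] at hp
      refine Ideal.Quotient.eq.2 (Ideal.mem_sup_left (Ideal.mem_sup_right ?_))
      simpa using Ideal.mem_map_of_mem (rename (R := k) (Sum.inr : κ → ι ⊕ κ)) hp
    have hxy : x α = y β :=
      Ideal.Quotient.eq.2 (Ideal.mem_sup_right (Ideal.mem_span_singleton_self _))
    have hxm (p : ι → ℕ) (m : ℕ) : x (p + m • α) = x p * x α ^ m := by
      simp only [x, Pi.add_apply, Pi.smul_apply, smul_eq_mul, pow_add, Finset.prod_mul_distrib,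
        map_mul, mul_comm m, pow_mul, Finset.prod_pow, map_pow]
    have hym (q : κ → ℕ) (m : ℕ) : y (q + m • β) = y q * y β ^ m := by
      simp only [y, Pi.add_apply, Pi.smul_apply, smul_eq_mul, pow_add, Finset.prod_mul_distrib,
        map_mul, mul_comm m, pow_mul, Finset.prod_pow, map_pow]
    refine definingIdeal_le fun r r' hr => ?_
    rw [degree_union, degree_union] at hr
    have hmk (r : ι ⊕ κ → ℕ) : Ideal.Quotient.mk J (∏ s, X s ^ r s) =
        x (fun i => r (.inl i)) * y (fun j => r (.inr j)) := by
      simp only [Fintype.prod_sum_type, map_mul, x, y]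
    rw [← Ideal.Quotient.eq, hmk, hmk]
    -- Modulo `J` only the degrees of the two factors matter, and `m` copies of `x ^ α` can be
    -- traded for `m` copies of `y ^ β`.
    obtain ⟨m, ⟨h₁, h₂⟩ | ⟨h₁, h₂⟩⟩ := h.exists_nat _ _ _ _ hr <;>
    · rw [← degree_smul, ← degree_add] at h₁ h₂
      rw [hx _ _ h₁, hy _ _ h₂, hxm, hym, hxy]
      ring
  · refine sup_le (sup_le (map_rename_inl_le_definingIdeal_union ..)
      (map_rename_inr_le_definingIdeal_union ..)) ?_
    rw [Ideal.span_singleton_le_iff_mem, binomial_mem_definingIdeal_union]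
    exact h.smul_degree

end Gluing

/-! ### Collinear families and the construction of gluings. -/

/-- Dividing one vector by the gcd of its coordinates gives a primitive vector; a natural vector
proportional to it is a natural multiple of it. -/
lemma exists_line_of_det_eq_zero {ι : Type*} [Nonempty ι] {v : ι → Fin 2 → ℕ}
    (h0 : ∀ i, v i ≠ 0) (hdet : ∀ i j, v i 0 * v j 1 = v i 1 * v j 0) :
    ∃ (b : Fin 2 → ℕ) (u : ι → ℕ), ∀ i, v i = u i • b := by
  obtain ⟨i⟩ := ‹Nonempty ι›
  have hpos : 0 < Nat.gcd (v i 0) (v i 1) := by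
    refine Nat.pos_of_ne_zero fun h => h0 i ?_
    rw [Nat.gcd_eq_zero_iff] at h
    ext l
    fin_cases l
    exacts [h.1, h.2]
  obtain ⟨x, y, hxy, hx, hy⟩ := Nat.exists_coprime (v i 0) (v i 1)
  set g := Nat.gcd (v i 0) (v i 1)
  have key (j : ι) : ∃ c : ℕ, v j = c • ![x, y] := by
    have h1 : x * v j 1 = y * v j 0 := by
      have := hdet i j
      rw [hx, hy] at this
      apply Nat.eq_of_mul_eq_mul_left hpos
      linarith
    obtain ⟨c, hc⟩ : x ∣ v j 0 := hxy.dvd_of_dvd_mul_left ⟨_, h1.symm⟩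
    -- If `x = 0`, the first coordinate carries no information; coprimality forces `y = 1`, and the
    -- multiplier is the second coordinate.
    rcases Nat.eq_zero_or_pos x with rfl | hx0
    · have hy1 : y = 1 := by simpa using hxy
      refine ⟨v j 1, ?_⟩
      ext l
      fin_cases l <;> simp_all
    · have h2 : v j 1 = y * c := by
        apply Nat.eq_of_mul_eq_mul_left hx0
        rw [h1, hc]
        ring
      refine ⟨c, ?_⟩
      ext l
      fin_cases l
      · simp [hc, mul_comm]
      · simp [h2, mul_comm]
  choose u hu using key
  exact ⟨_, u, hu⟩

lemma exists_coprime_sum {κ : Type*} [Fintype κ] {v : κ → ℕ} (hv : Finset.univ.gcd v = 1)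
    {M : ℕ} (hM : 0 < M) :
    ∃ β : κ → ℕ, 0 < ∑ j, β j * v j ∧ Nat.Coprime (∑ j, β j * v j) M := by
  obtain ⟨c, hc⟩ := Finset.gcd_eq_sum_mul Finset.univ (fun j => (v j : ℤ))
  have hgcd : Finset.univ.gcd (fun j => (v j : ℤ)) = 1 := by
    have h1 : (Finset.univ.gcd (fun j => (v j : ℤ))).natAbs ∣ Finset.univ.gcd v :=
      Finset.dvd_gcd fun j hj => by
        simpa using Int.natAbs_dvd_natAbs.2 (Finset.gcd_dvd (f := fun j => (v j : ℤ)) hj)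
    rw [hv, Nat.dvd_one] at h1
    have := Finset.Int.finsetGcd_nonneg (s := Finset.univ) (f := fun j => (v j : ℤ))
    lia
  rw [hgcd] at hc
  have hM' : (0 : ℤ) < M := by exact_mod_cast hM
  -- Bézout coefficients reduced modulo `M` keep the sum congruent to 1; adding `M` makes every
  -- coefficient positive.
  refine ⟨fun j => (c j % M).toNat + M, ?_, ?_⟩
  · obtain ⟨j, hj⟩ : ∃ j, v j ≠ 0 := by
      by_contra! h
      rw [Finset.gcd_eq_zero_iff.2 fun j _ => h j] at hv
      exact zero_ne_one hv
    refine lt_of_lt_of_le ?_ (Finset.single_le_sum (fun _ _ => Nat.zero_le _) (Finset.mem_univ j))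
    positivity
  · have hmod : ((∑ j, ((c j % M).toNat + M) * v j : ℕ) : ℤ) ≡ 1 [ZMOD M] := by
      rw [hc]
      push_cast
      refine Int.ModEq.sum fun j _ => ?_
      rw [Int.toNat_of_nonneg (Int.emod_nonneg _ hM'.ne'), mul_comm (v j : ℤ)]
      refine Int.ModEq.mul_right _ ?_
      exact (Int.add_modEq_right).trans (Int.mod_modEq _ _)
    have hmod' : ∑ j, ((c j % M).toNat + M) * v j ≡ 1 [MOD M] := by
      exact_mod_cast (Int.natCast_modEq_iff).1 (by exact_mod_cast hmod)
    simpa [Nat.Coprime] using hmod'.gcd_eq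

section

variable {n : ℕ} {ι κ : Type*} [Fintype ι] [Fintype κ]

lemma degree_of_line {b : κ → Fin n → ℕ} {e : Fin n → ℕ} {u : κ → ℕ} (hu : ∀ j, b j = u j • e)
    (q : κ → ℕ) : degree b q = (∑ j, q j * u j) • e := by
  simp [degree, hu, Finset.sum_smul, mul_smul]

/-- After extracting the gcd, `b j = v j • f` with `f = g • e`. Choose `N = ∑ β j * v j` coprime to
`d * f l`, where `f l ≠ 0`, and take `k₁ = N`, `k₂ = d`, so that `degree a α = d • f` and `degree b
β = N • f`. If `N P + d s f = N P' + d s' f`, coordinate `l` gives `N ∣ s' - s`; cancelling `N` then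
compares `P` with `P'`. -/
lemma exists_isBalanced_of_line [Nonempty κ] {a : ι → Fin n → ℕ} {b : κ → Fin n → ℕ}
    (hb0 : ∀ j, b j ≠ 0) {e : Fin n → ℕ} {u : κ → ℕ} (hu : ∀ j, b j = u j • e)
    {d : ℕ} (hd : 0 < d) {x : ι → ℕ} (hx : degree a x = d • e) :
    ∃ (k₁ k₂ : ℕ) (α : ι → ℕ) (β : κ → ℕ), 0 < k₁ ∧ 0 < k₂ ∧ IsBalanced k₁ k₂ a b α β ∧ β ≠ 0 := by
  obtain ⟨v, hv, hv1⟩ := Finset.extract_gcd u Finset.univ_nonempty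
  set g := Finset.univ.gcd u
  have hbv (j) : b j = v j • (g • e) := by
    rw [hu, hv j (Finset.mem_univ j), mul_comm, mul_smul]
  obtain ⟨l, hl⟩ : ∃ l, (g • e) l ≠ 0 := by
    by_contra! h
    obtain ⟨j⟩ := ‹Nonempty κ›
    exact hb0 j (by rw [hbv, funext h]; exact smul_zero _)
  have hx' : degree a (g • x) = d • (g • e) := by
    rw [degree_smul, hx, smul_comm]
  obtain ⟨β, hN, hcop⟩ := exists_coprime_sum hv1 (Nat.mul_pos hd (Nat.pos_of_ne_zero hl))
  set N := ∑ j, β j * v j with hNdef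
  refine ⟨N, d, g • x, β, hN, hd, ⟨?_, fun p p' q q' h => ?_⟩, ?_⟩
  · rw [hx', degree_of_line hbv, smul_comm]
  · rw [degree_of_line hbv, degree_of_line hbv] at *
    rw [hx', degree_of_line hbv, ← hNdef]
    generalize ∑ j, q j * v j = s at *
    generalize ∑ j, q' j * v j = s' at *
    generalize degree a p = P at *
    generalize degree a p' = P' at *
    generalize g • e = f at *
    have hdvd : (N : ℤ) ∣ s' - s := by
      have hl' := congrFun h l
      simp only [Pi.add_apply, Pi.smul_apply, smul_eq_mul] at hl'
      have hcop' : IsCoprime (N : ℤ) ((d * f l : ℕ) : ℤ) := Nat.isCoprime_iff_coprime.2 hcop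
      refine hcop'.dvd_of_dvd_mul_left ⟨P l - P' l, ?_⟩
      zify at hl'
      push_cast
      linarith
    obtain ⟨c, hc⟩ := hdvd
    rcases le_total s s' with hs | hs
    · have hc0 : 0 ≤ c := by
        by_contra! h
        have : (N : ℤ) * c < 0 := mul_neg_of_pos_of_neg (by exact_mod_cast hN) h
        lia
      lift c to ℕ using hc0
      have hs' : s' = s + c * N := by zify; linarith
      refine ⟨c, .inl ⟨?_, by rw [hs', add_smul, mul_smul]⟩⟩
      ext i
      have := congrFun h i
      simp only [Pi.add_apply, Pi.smul_apply, smul_eq_mul, hs'] at this ⊢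
      apply Nat.eq_of_mul_eq_mul_left hN
      linarith
    · have hc0 : c ≤ 0 := by
        by_contra! h
        have : (0 : ℤ) < N * c := mul_pos (by exact_mod_cast hN) h
        lia
      obtain ⟨c, rfl⟩ : ∃ c' : ℕ, c = -c' := ⟨c.natAbs, by lia⟩
      have hs' : s = s' + c * N := by zify; linarith
      refine ⟨c, .inr ⟨?_, by rw [hs', add_smul, mul_smul]⟩⟩
      ext i
      have := congrFun h i
      simp only [Pi.add_apply, Pi.smul_apply, smul_eq_mul, hs'] at this ⊢
      apply Nat.eq_of_mul_eq_mul_left hN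
      linarith
  · rintro rfl
    simp [hNdef] at hN

variable {k : Type*} [Field k]

lemma exponents_ne_zero_of_gluing {k₁ k₂ : ℕ} (hk₁ : 0 < k₁) (hk₂ : 0 < k₂)
    {a : ι → Fin n → ℕ} {b : κ → Fin n → ℕ} (ha : ∀ i, a i ≠ 0) (hb : ∀ j, b j ≠ 0)
    {α : ι → ℕ} {β : κ → ℕ} (h0 : α ≠ 0 ∨ β ≠ 0) (h : k₁ • degree a α = k₂ • degree b β) :
    α ≠ 0 ∧ β ≠ 0 := by
  by_contra hne
  have : α = 0 ∧ β = 0 := by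
    rcases not_and_or.1 hne with h' | h' <;> rw [not_not] at h' <;> subst h'
    · rw [degree_zero, smul_zero, eq_comm, smul_eq_zero_iff_right hk₂.ne'] at h
      exact ⟨rfl, degree_eq_zero hb h⟩
    · rw [degree_zero, smul_zero, smul_eq_zero_iff_right hk₁.ne'] at h
      exact ⟨degree_eq_zero ha h, rfl⟩
  tauto

end

/-! ### Rank obstruction in the plane. -/

section Plane

lemma sum_single_add_single_mul {n : ℕ} {τ : Type*} [Fintype τ] [DecidableEq τ]
    (v : τ → Fin n → ℕ) (t t' : τ) (x y : ℤ) (l : Fin n) :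
    ∑ s, (Pi.single t x + Pi.single t' y : τ → ℤ) s * v s l = x * v t l + y * v t' l := by
  simp [add_mul, Finset.sum_add_distrib, Pi.single_apply]

variable {k : Type*} [Field k] {ι κ : Type*} [Fintype ι] [Fintype κ]

lemma det_eq_zero_of_gluing {k₁ k₂ : ℕ} (hk₂ : 0 < k₂)
    {a : ι → Fin 2 → ℕ} {b : κ → Fin 2 → ℕ} {α : ι → ℕ} {β : κ → ℕ}
    (hI : definingIdeal k (union k₁ k₂ a b) =
      (definingIdeal k a).map (rename (R := k) (Sum.inl : ι → ι ⊕ κ)) ⊔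
      (definingIdeal k b).map (rename (R := k) (Sum.inr : κ → ι ⊕ κ)) ⊔
      Ideal.span {binomial k α β}) :
    (∀ i i', a i 0 * a i' 1 = a i 1 * a i' 0) ∨ ∀ j j', b j 0 * b j' 1 = b j 1 * b j' 0 := by
  classical
  by_contra! h
  obtain ⟨⟨i, i', hA⟩, j, j', hB⟩ := h
  set DA : ℤ := a i 0 * a i' 1 - a i 1 * a i' 0
  set DB : ℤ := b j 0 * b j' 1 - b j 1 * b j' 0
  have hDA : DA ≠ 0 := by simpa [DA, sub_eq_zero] using mod_cast hA
  have hDB : DB ≠ 0 := by simpa [DB, sub_eq_zero] using mod_cast hB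
  -- Cramer's rule: scaled by both determinants, any integer vector is an integer combination of `a
  -- i, a i'` and of `b j, b j'`. The factors `k₂` and `k₁` put the resulting vector in both scaled
  -- lattices.
  have key (z w : ℤ) : ∃ m : ℤ, k₂ * DA * DB * z = m * degree a α 0 ∧
      k₂ * DA * DB * w = m * degree a α 1 := by
    obtain ⟨m, hm⟩ := exists_int_of_gluing_of_int hI
      (Pi.single i (k₂ * DB * (a i' 1 * z - a i' 0 * w)) +
        Pi.single i' (k₂ * DB * (a i 0 * w - a i 1 * z)))
      (Pi.single j (k₁ * DA * (b j' 1 * z - b j' 0 * w)) +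
        Pi.single j' (k₁ * DA * (b j 0 * w - b j 1 * z))) (fun l => by
        rw [sum_single_add_single_mul, sum_single_add_single_mul]
        fin_cases l <;> simp only [DA, DB, Fin.zero_eta, Fin.mk_one] <;> ring)
    simp only [sum_single_add_single_mul] at hm
    refine ⟨m, ?_, ?_⟩
    · rw [← hm 0]; simp only [DA]; ring
    · rw [← hm 1]; simp only [DA]; ring
  obtain ⟨m, h1, h2⟩ := key 1 0
  obtain ⟨m', h3, h4⟩ := key 0 1
  have hne : (k₂ : ℤ) * DA * DB ≠ 0 :=
    mul_ne_zero (mul_ne_zero (by exact_mod_cast hk₂.ne') hDA) hDB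
  rw [mul_one] at h1 h4
  -- Nonzero multiples of both standard basis vectors cannot be multiples of the single vector
  -- `degree a α`.
  rw [mul_zero, eq_comm, mul_eq_zero] at h2 h3
  rcases h2 with rfl | h2
  · simp [hne] at h1
  · simp [hne, h2] at h4

end Plane

section Columns

lemma exists_line_of_isPointOrLine {n : ℕ} {B : Finset (Fin n → ℕ)} {b : Fin n → ℕ}
    (h : IsPointOrLine B b) : B.Nonempty ∧ ∃ u : B → ℕ, ∀ c, columns B c = u c • b := by
  rcases h with rfl | ⟨hc, hu⟩
  · exact ⟨Finset.singleton_nonempty b, fun _ => 1,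
      fun c => by rw [one_smul]; exact Finset.mem_singleton.1 c.2⟩
  · exact ⟨Finset.card_pos.1 (by lia), hu⟩

/-- The direction may change: a singleton must be represented by its own element. -/
lemma exists_isPointOrLine {n : ℕ} {B : Finset (Fin n → ℕ)} (hB : B.Nonempty) {b : Fin n → ℕ}
    {u : B → ℕ} (hu : ∀ c, columns B c = u c • b) : ∃ b, IsPointOrLine B b := by
  by_cases h : 2 ≤ B.card
  · exact ⟨b, .inr ⟨h, u, hu⟩⟩
  · obtain ⟨b, hb⟩ := Finset.card_eq_one.1 (le_antisymm (by lia) (Finset.card_pos.2 hB))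
    exact ⟨b, .inl hb⟩

lemma exists_isPointOrLine_and_hasMultipleIn {n : ℕ} {A B : Finset (Fin n → ℕ)} {k₁ k₂ : ℕ}
    (hk₂ : 0 < k₂) (hB0 : 0 ∉ B) (hB : B.Nonempty) {b : Fin n → ℕ} {u : B → ℕ}
    (hu : ∀ c, columns B c = u c • b) {α : A → ℕ} {β : B → ℕ} (hβ : β ≠ 0)
    (h : k₁ • degree (columns A) α = k₂ • degree (columns B) β) :
    ∃ b, IsPointOrLine B b ∧ HasMultipleIn A b := by
  obtain ⟨b, hb⟩ := exists_isPointOrLine hB hu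
  obtain ⟨-, u, hu⟩ := exists_line_of_isPointOrLine hb
  refine ⟨b, hb, k₂ * ∑ j, β j * u j, Nat.mul_pos hk₂ (Nat.pos_of_ne_zero fun h0 => hβ ?_),
    k₁ • α, ?_⟩
  · refine degree_eq_zero (a := columns B) (fun c hc => hB0 (hc ▸ c.2)) ?_
    rw [degree_of_line hu, h0, zero_smul]
  · rw [mul_smul, ← degree_of_line hu, ← h, ← degree_smul]
    rfl

end Columns

/-! ### Semigroup rings of gluings as tensor products. -/

open TensorProduct

section

variable {k : Type*} [Field k] {n : ℕ} {ι κ : Type*} [Fintype ι] [Fintype κ]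

/-- The monomial `x ^ p` as an element of the semigroup ring. -/
noncomputable abbrev semigroupRing.monomial (k : Type*) [Field k] (a : ι → Fin n → ℕ)
    (p : ι → ℕ) : semigroupRing k a :=
  Ideal.Quotient.mkₐ k (definingIdeal k a) (∏ i, X i ^ p i)

lemma semigroupRing.monomial_eq_iff {a : ι → Fin n → ℕ} {p q : ι → ℕ} :
    semigroupRing.monomial k a p = semigroupRing.monomial k a q ↔ degree a p = degree a q := by
  rw [← prod_sub_prod_mem_definingIdeal (k := k)]
  exact Ideal.Quotient.eq

lemma semigroupRing.monomial_smul (a : ι → Fin n → ℕ) (m : ℕ) (p : ι → ℕ) :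
    semigroupRing.monomial k a (m • p) = semigroupRing.monomial k a p ^ m := by
  rw [semigroupRing.monomial, semigroupRing.monomial, ← map_pow, ← Finset.prod_pow]
  simp only [Pi.smul_apply, smul_eq_mul, mul_comm m, pow_mul]

lemma aeval_monomial_injective {p : ι → ℕ} (hp : p ≠ 0) :
    Function.Injective (Polynomial.aeval (R := k) (∏ i, X (R := k) i ^ p i)) := by
  classical
  rw [injective_iff_map_eq_zero]
  intro f hf
  ext m
  have hmon (m : ℕ) : (∏ i, X (R := k) i ^ p i) ^ m =
      monomial (m • Finsupp.equivFunOnFinite.symm p) 1 := by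
    rw [monomial_eq_smul_prod, one_smul, ← Finset.prod_pow]
    simp [mul_comm m, pow_mul]
  have hinj (i j : ℕ) : i • Finsupp.equivFunOnFinite.symm p = j • Finsupp.equivFunOnFinite.symm p ↔
      i = j := by
    refine ⟨fun h => ?_, fun h => h ▸ rfl⟩
    obtain ⟨s, hs⟩ := Function.ne_iff.1 hp
    have := DFunLike.congr_fun h s
    simp only [Finsupp.coe_smul, Pi.smul_apply, Finsupp.equivFunOnFinite_symm_apply_apply,
      smul_eq_mul] at this
    exact Nat.eq_of_mul_eq_mul_right (Nat.pos_of_ne_zero hs) this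
  have := congrArg (coeff (m • Finsupp.equivFunOnFinite.symm p)) hf
  rw [Polynomial.aeval_eq_sum_range, coeff_sum] at this
  simp only [hmon, coeff_smul, coeff_monomial, hinj, smul_eq_mul, mul_ite, mul_one, mul_zero,
    Finset.sum_ite_eq', Finset.mem_range, coeff_zero] at this
  split_ifs at this with h
  · simpa using this
  · simpa using Polynomial.coeff_eq_zero_of_natDegree_lt (by lia)

lemma semigroupRing.aeval_monomial_injective {a : ι → Fin n → ℕ} {p : ι → ℕ}
    (hp : degree a p ≠ 0) :
    Function.Injective (Polynomial.aeval (R := k) (semigroupRing.monomial k a p)) := by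
  let g : semigroupRing k a →ₐ[k] MvPolynomial (Fin n) k :=
    Ideal.Quotient.liftₐ (definingIdeal k a) (monomialHom k a) fun _ h => h
  have hg : g (semigroupRing.monomial k a p) = ∏ l, X l ^ degree a p l := monomialHom_prod a p
  refine Function.Injective.of_comp (f := g) ?_
  rw [← AlgHom.coe_comp, ← Polynomial.aeval_algHom, hg]
  exact AffineSemigroup.aeval_monomial_injective hp

/-- With `N = ∑ β j * u j`, the monomials `y_j ^ N` and `(y ^ β) ^ u j` have the same degree, so
each generator has a power in the image of `k[z]`. -/
lemma semigroupRing.isIntegral_of_line {b : κ → Fin n → ℕ} {e : Fin n → ℕ} {u : κ → ℕ}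
    (hu : ∀ j, b j = u j • e) {β : κ → ℕ} (hβ : degree b β ≠ 0)
    [Algebra (Polynomial k) (semigroupRing k b)]
    (h : ∀ f : Polynomial k, algebraMap (Polynomial k) (semigroupRing k b) f =
      Polynomial.aeval (semigroupRing.monomial k b β) f) :
    Algebra.IsIntegral (Polynomial k) (semigroupRing k b) := by
  classical
  have hN : 0 < ∑ j, β j * u j := by
    refine Nat.pos_of_ne_zero fun h0 => hβ ?_
    rw [degree_of_line hu, h0, zero_smul]
  refine ⟨fun x => ?_⟩
  obtain ⟨f, rfl⟩ := Ideal.Quotient.mk_surjective x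
  induction f using MvPolynomial.induction_on with
  | C c =>
    have : Ideal.Quotient.mk (definingIdeal k b) (C c) =
        algebraMap (Polynomial k) (semigroupRing k b) (Polynomial.C c) := by
      rw [h, Polynomial.aeval_C]
      rfl
    rw [this]
    exact isIntegral_algebraMap
  | add f g hf hg => rw [map_add]; exact hf.add hg
  | mul_X f j hf =>
    rw [map_mul]
    refine hf.mul (IsIntegral.of_pow hN ?_)
    have hj : Ideal.Quotient.mk (definingIdeal k b) (X j) =
        semigroupRing.monomial k b (Pi.single j 1) := by
      rw [semigroupRing.monomial, Ideal.Quotient.mkₐ_eq_mk, Finset.prod_eq_single j] <;>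
        simp +contextual
    have : Ideal.Quotient.mk (definingIdeal k b) (X j) ^ ∑ j, β j * u j =
        algebraMap (Polynomial k) (semigroupRing k b) (Polynomial.X ^ u j) := by
      rw [h, map_pow, Polynomial.aeval_X, hj, ← semigroupRing.monomial_smul,
        ← semigroupRing.monomial_smul, semigroupRing.monomial_eq_iff, degree_smul, degree_smul,
        degree_single, one_smul, degree_of_line hu, hu, smul_comm]
    rw [this]
    exact isIntegral_algebraMap

/-- A semigroup ring of dimension one is finite and flat over the polynomial ring generated by a
nonconstant monomial. -/
lemma semigroupRing.finite_and_flat_of_line {b : κ → Fin n → ℕ} {e : Fin n → ℕ} {u : κ → ℕ}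
    (hu : ∀ j, b j = u j • e) {β : κ → ℕ} (hβ : degree b β ≠ 0)
    [Algebra (Polynomial k) (semigroupRing k b)]
    (h : ∀ f : Polynomial k, algebraMap (Polynomial k) (semigroupRing k b) f =
      Polynomial.aeval (semigroupRing.monomial k b β) f) :
    Module.Finite (Polynomial k) (semigroupRing k b) ∧
      Module.Flat (Polynomial k) (semigroupRing k b) := by
  have := semigroupRing.isIntegral_of_line hu hβ h
  have : IsScalarTower k (Polynomial k) (semigroupRing k b) :=
    .of_algebraMap_eq fun c => by
      rw [h, Polynomial.algebraMap_eq, Polynomial.aeval_C]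
  have : Algebra.FiniteType (Polynomial k) (semigroupRing k b) :=
    .of_restrictScalars_finiteType k _ _
  -- The ring is a domain containing `k[z]`, hence torsion-free; over a principal ideal domain this
  -- gives flatness.
  have : Module.IsTorsionFree (Polynomial k) (semigroupRing k b) := by
    rw [Module.isTorsionFree_iff_algebraMap_injective, funext h]
    exact semigroupRing.aeval_monomial_injective hβ
  exact ⟨Algebra.IsIntegral.finite, inferInstance⟩

set_option maxHeartbeats 800000 in
/-- The semigroup ring of a gluing is the tensor product `k[A] ⊗ k[B]` over `k[z]`, where `z` acts
on `k[A]` as `x ^ α` and on `k[B]` as `y ^ β`. -/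
lemma nonempty_ringEquiv_tensorProduct {k₁ k₂ : ℕ} {a : ι → Fin n → ℕ} {b : κ → Fin n → ℕ}
    {α : ι → ℕ} {β : κ → ℕ}
    (hI : definingIdeal k (union k₁ k₂ a b) =
      (definingIdeal k a).map (rename (R := k) (Sum.inl : ι → ι ⊕ κ)) ⊔
      (definingIdeal k b).map (rename (R := k) (Sum.inr : κ → ι ⊕ κ)) ⊔
      Ideal.span {binomial k α β})
    [Algebra (Polynomial k) (semigroupRing k a)] [Algebra (Polynomial k) (semigroupRing k b)]
    (ha : ∀ f : Polynomial k, algebraMap (Polynomial k) (semigroupRing k a) f =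
      Polynomial.aeval (semigroupRing.monomial k a α) f)
    (hb : ∀ f : Polynomial k, algebraMap (Polynomial k) (semigroupRing k b) f =
      Polynomial.aeval (semigroupRing.monomial k b β) f) :
    Nonempty (semigroupRing k (union k₁ k₂ a b) ≃+*
      semigroupRing k a ⊗[Polynomial k] semigroupRing k b) := by
  have : IsScalarTower k (Polynomial k) (semigroupRing k a) :=
    .of_algebraMap_eq fun c => by rw [ha, Polynomial.algebraMap_eq, Polynomial.aeval_C]
  have : IsScalarTower k (Polynomial k) (semigroupRing k b) :=
    .of_algebraMap_eq fun c => by rw [hb, Polynomial.algebraMap_eq, Polynomial.aeval_C]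
  let S := semigroupRing k (union k₁ k₂ a b)
  let T := semigroupRing k a ⊗[Polynomial k] semigroupRing k b
  let il : semigroupRing k a →ₐ[k] T :=
    (Algebra.TensorProduct.includeLeft :
      semigroupRing k a →ₐ[Polynomial k] T).restrictScalars k
  let ir : semigroupRing k b →ₐ[k] T :=
    (Algebra.TensorProduct.includeRight :
      semigroupRing k b →ₐ[Polynomial k] T).restrictScalars k
  let f₀ : MvPolynomial (ι ⊕ κ) k →ₐ[k] T := aeval (Sum.elim
    (fun i => il (Ideal.Quotient.mkₐ k (definingIdeal k a) (X i))) 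
    (fun j => ir (Ideal.Quotient.mkₐ k (definingIdeal k b) (X j))))
  have hfl : f₀.comp (rename Sum.inl) = il.comp (Ideal.Quotient.mkₐ k (definingIdeal k a)) := by
    ext i; simp [f₀]
  have hfr : f₀.comp (rename Sum.inr) = ir.comp (Ideal.Quotient.mkₐ k (definingIdeal k b)) := by
    ext j; simp [f₀]
  have hfl' (x) : f₀ (rename Sum.inl x) = il (Ideal.Quotient.mkₐ k (definingIdeal k a) x) :=
    DFunLike.congr_fun hfl x
  have hfr' (x) : f₀ (rename Sum.inr x) = ir (Ideal.Quotient.mkₐ k (definingIdeal k b) x) :=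
    DFunLike.congr_fun hfr x
  have hglue : il (semigroupRing.monomial k a α) = ir (semigroupRing.monomial k b β) := by
    have h1 := ha Polynomial.X
    have h2 := hb Polynomial.X
    rw [Polynomial.aeval_X] at h1 h2
    rw [← h1, ← h2]
    exact (AlgHom.commutes (Algebra.TensorProduct.includeLeft :
      semigroupRing k a →ₐ[Polynomial k] T) _).trans
      (AlgHom.commutes (Algebra.TensorProduct.includeRight :
        semigroupRing k b →ₐ[Polynomial k] T) _).symm
  have hf₀ : definingIdeal k (union k₁ k₂ a b) ≤ RingHom.ker f₀ := by
    rw [hI]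
    refine sup_le (sup_le ?_ ?_) ?_
    · rw [Ideal.map_le_iff_le_comap]
      intro x hx
      rw [Ideal.mem_comap, RingHom.mem_ker, hfl', Ideal.Quotient.mkₐ_eq_mk,
        Ideal.Quotient.eq_zero_iff_mem.2 hx, map_zero]
    · rw [Ideal.map_le_iff_le_comap]
      intro x hx
      rw [Ideal.mem_comap, RingHom.mem_ker, hfr', Ideal.Quotient.mkₐ_eq_mk,
        Ideal.Quotient.eq_zero_iff_mem.2 hx, map_zero]
    · rw [Ideal.span_singleton_le_iff_mem, RingHom.mem_ker, binomial_eq, map_sub,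
        ← rename_inl_prod, ← rename_inr_prod, hfl', hfr', sub_eq_zero]
      exact hglue
  let f : S →ₐ[k] T := Ideal.Quotient.liftₐ _ f₀ hf₀
  let gl : semigroupRing k a →ₐ[k] S := Ideal.quotientMapₐ _ (rename Sum.inl)
    (Ideal.map_le_iff_le_comap.1 (map_rename_inl_le_definingIdeal_union k₁ k₂ a b))
  let gr : semigroupRing k b →ₐ[k] S := Ideal.quotientMapₐ _ (rename Sum.inr)
    (Ideal.map_le_iff_le_comap.1 (map_rename_inr_le_definingIdeal_union k₁ k₂ a b))
  have hglr : gl (semigroupRing.monomial k a α) = gr (semigroupRing.monomial k b β) := by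
    have hmem : binomial k α β ∈ definingIdeal k (union k₁ k₂ a b) :=
      hI ▸ Ideal.mem_sup_right (Ideal.mem_span_singleton_self _)
    rw [binomial_eq, ← rename_inl_prod, ← rename_inr_prod] at hmem
    exact Ideal.Quotient.eq.2 hmem
  -- Let `z` act on `k[C]` as the common image of `x ^ α` and `y ^ β`; both inclusions become
  -- `k[z]`-linear and induce the map from the tensor product.
  let zS : Polynomial k →ₐ[k] S := Polynomial.aeval (gl (semigroupRing.monomial k a α))
  let := zS.toRingHom.toAlgebra
  let glP : semigroupRing k a →ₐ[Polynomial k] S :=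
    { gl with
      commutes' := fun p => by
        change gl (algebraMap _ _ p) = zS p
        rw [ha, ← Polynomial.aeval_algHom_apply] }
  let grP : semigroupRing k b →ₐ[Polynomial k] S :=
    { gr with
      commutes' := fun p => by
        change gr (algebraMap _ _ p) = zS p
        rw [hb, ← Polynomial.aeval_algHom_apply, ← hglr] }
  let g : T →ₐ[Polynomial k] S := Algebra.TensorProduct.lift glP grP fun _ _ => Commute.all _ _
  have hgl (x) : g (il x) = gl x := by
    exact Algebra.TensorProduct.lift_tmul _ _ _ x 1 |>.trans (by rw [map_one, mul_one]; rfl)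
  have hgr (x) : g (ir x) = gr x := by
    exact Algebra.TensorProduct.lift_tmul _ _ _ 1 x |>.trans (by rw [map_one, one_mul]; rfl)
  have hfgl (x) : f (gl x) = il x := by
    obtain ⟨x, rfl⟩ := Ideal.Quotient.mk_surjective x
    exact hfl' x
  have hfgr (x) : f (gr x) = ir x := by
    obtain ⟨x, rfl⟩ := Ideal.Quotient.mk_surjective x
    exact hfr' x
  refine ⟨RingEquiv.ofRingHom f.toRingHom g.toRingHom ?_ ?_⟩
  · refine RingHom.ext fun t => ?_
    change f (g t) = t
    induction t using TensorProduct.induction_on with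
    | zero => simp
    | add x y hx hy => rw [map_add, map_add, hx, hy]
    | tmul x y =>
      have : x ⊗ₜ[Polynomial k] y = il x * ir y := by
        exact (Algebra.TensorProduct.tmul_mul_tmul x 1 1 y).trans (by rw [mul_one, one_mul]) |>.symm
      rw [this, map_mul, map_mul, hgl, hgr, hfgl, hfgr]
  · have hl (x) : g (f₀ (rename Sum.inl x)) = Ideal.Quotient.mk _ (rename Sum.inl x) := by
      rw [hfl', hgl]
      rfl
    have hr (x) : g (f₀ (rename Sum.inr x)) = Ideal.Quotient.mk _ (rename Sum.inr x) := by
      rw [hfr', hgr]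
      rfl
    have hgf : g.toRingHom.comp f₀.toRingHom = Ideal.Quotient.mk _ := by
      refine MvPolynomial.ringHom_ext (fun c => ?_) fun s => ?_
      · have := hl (C c)
        rwa [rename_C] at this
      · rcases s with i | j
        · have := hl (X i)
          rwa [rename_X] at this
        · have := hr (X j)
          rwa [rename_X] at this
    refine RingHom.ext fun x => ?_
    obtain ⟨x, rfl⟩ := Ideal.Quotient.mk_surjective x
    exact DFunLike.congr_fun hgf x

theorem isCohenMacaulay_union_of_line {k₁ k₂ : ℕ} {a : ι → Fin n → ℕ} {b : κ → Fin n → ℕ}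
    {α : ι → ℕ} {β : κ → ℕ}
    (hI : definingIdeal k (union k₁ k₂ a b) =
      (definingIdeal k a).map (rename (R := k) (Sum.inl : ι → ι ⊕ κ)) ⊔
      (definingIdeal k b).map (rename (R := k) (Sum.inr : κ → ι ⊕ κ)) ⊔
      Ideal.span {binomial k α β})
    (hα : degree a α ≠ 0) (hβ : degree b β ≠ 0)
    (hA : IsCohenMacaulay (semigroupRing k a)) (hB : IsCohenMacaulay (semigroupRing k b))
    (hline : (∃ (e : Fin n → ℕ) (u : κ → ℕ), ∀ j, b j = u j • e) ∨
      ∃ (e : Fin n → ℕ) (u : ι → ℕ), ∀ i, a i = u i • e) :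
    IsCohenMacaulay (semigroupRing k (union k₁ k₂ a b)) := by
  let : Algebra (Polynomial k) (semigroupRing k a) :=
    (Polynomial.aeval (R := k) (semigroupRing.monomial k a α)).toRingHom.toAlgebra
  let : Algebra (Polynomial k) (semigroupRing k b) :=
    (Polynomial.aeval (R := k) (semigroupRing.monomial k b β)).toRingHom.toAlgebra
  obtain ⟨E⟩ := nonempty_ringEquiv_tensorProduct hI (fun _ => rfl) (fun _ => rfl)
  refine IsCohenMacaulay.of_ringEquiv
    (R := semigroupRing k a ⊗[Polynomial k] semigroupRing k b) E.symm ?_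
  rcases hline with ⟨e, u, hu⟩ | ⟨e, u, hu⟩
  · obtain ⟨_, _⟩ := semigroupRing.finite_and_flat_of_line (k := k) hu hβ (fun _ => rfl)
    exact hA.of_finite_flat
  · obtain ⟨_, _⟩ := semigroupRing.finite_and_flat_of_line (k := k) hu hα (fun _ => rfl)
    exact IsCohenMacaulay.of_ringEquiv
      (R := semigroupRing k b ⊗[Polynomial k] semigroupRing k a)
      (Algebra.TensorProduct.comm (Polynomial k) (semigroupRing k b) (semigroupRing k a)).toRingEquiv
      hB.of_finite_flat

end

end AffineSemigroup

theorem theorem5p1 (k : Type*) [Field k] (A B : Finset (Fin 2 → ℕ))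
    (hA0 : (0 : Fin 2 → ℕ) ∉ A) (hB0 : (0 : Fin 2 → ℕ) ∉ B)
    (hA : IsCohenMacaulay (AffineSemigroup.semigroupRing k (AffineSemigroup.columns A)))
    (hB : IsCohenMacaulay (AffineSemigroup.semigroupRing k (AffineSemigroup.columns B))) :
    (AffineSemigroup.CanBeGlued k (AffineSemigroup.columns A) (AffineSemigroup.columns B) ↔
      (∃ b : Fin 2 → ℕ, AffineSemigroup.IsPointOrLine B b ∧ AffineSemigroup.HasMultipleIn A b) ∨
      (∃ a : Fin 2 → ℕ, AffineSemigroup.IsPointOrLine A a ∧ AffineSemigroup.HasMultipleIn B a)) ∧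
    ∀ k₁ k₂ : ℕ, 0 < k₁ → 0 < k₂ →
      AffineSemigroup.IsGluing k k₁ k₂ (AffineSemigroup.columns A) (AffineSemigroup.columns B) →
      IsCohenMacaulay (AffineSemigroup.semigroupRing k
        (AffineSemigroup.union k₁ k₂ (AffineSemigroup.columns A) (AffineSemigroup.columns B))) := by
  open AffineSemigroup in
  have hA0' (c : A) : columns A c ≠ 0 := fun hc => hA0 (hc ▸ c.2)
  have hB0' (c : B) : columns B c ≠ 0 := fun hc => hB0 (hc ▸ c.2)
  -- Since no generator is 0, a nonzero gluing binomial involves variables from both sides; this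
  -- also rules out empty `A` or `B`.
  have key {k₁ k₂ : ℕ} (hk₁ : 0 < k₁) (hk₂ : 0 < k₂) {α : A → ℕ} {β : B → ℕ}
      (h0 : binomial k α β ≠ 0) (hI : definingIdeal k (union k₁ k₂ (columns A) (columns B)) =
        (definingIdeal k (columns A)).map (MvPolynomial.rename (R := k) (Sum.inl : A → A ⊕ B)) ⊔
        (definingIdeal k (columns B)).map (MvPolynomial.rename (R := k) (Sum.inr : B → A ⊕ B)) ⊔
        Ideal.span {binomial k α β}) :
      k₁ • degree (columns A) α = k₂ • degree (columns B) β ∧ α ≠ 0 ∧ β ≠ 0 ∧ A.Nonempty ∧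
        B.Nonempty ∧ ((∃ (e : Fin 2 → ℕ) (u : B → ℕ), ∀ j, columns B j = u j • e) ∨
          ∃ (e : Fin 2 → ℕ) (u : A → ℕ), ∀ i, columns A i = u i • e) := by
    have hdeg := binomial_mem_definingIdeal_union.1
      (hI ▸ Ideal.mem_sup_right (Ideal.mem_span_singleton_self _))
    obtain ⟨hα, hβ⟩ := exponents_ne_zero_of_gluing hk₁ hk₂ hA0' hB0'
      (binomial_ne_zero_iff.1 h0) hdeg
    obtain ⟨i, -⟩ := Function.ne_iff.1 hα
    obtain ⟨j, -⟩ := Function.ne_iff.1 hβ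
    have : Nonempty A := ⟨i⟩
    have : Nonempty B := ⟨j⟩
    exact ⟨hdeg, hα, hβ, ⟨i, i.2⟩, ⟨j, j.2⟩, (det_eq_zero_of_gluing hk₂ hI).symm.imp
      (exists_line_of_det_eq_zero hB0') (exists_line_of_det_eq_zero hA0')⟩
  refine ⟨⟨?_, ?_⟩, ?_⟩
  · rintro ⟨k₁, k₂, hk₁, hk₂, α, β, h0, hI⟩
    obtain ⟨hdeg, hα, hβ, hAne, hBne, ⟨e, u, hu⟩ | ⟨e, u, hu⟩⟩ := key hk₁ hk₂ h0 hI
    · exact .inl (exists_isPointOrLine_and_hasMultipleIn hk₂ hB0 hBne hu hβ hdeg)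
    · exact .inr (exists_isPointOrLine_and_hasMultipleIn hk₁ hA0 hAne hu hα hdeg.symm)
  · rintro (⟨b, hb, d, hd, x, hx⟩ | ⟨b, hb, d, hd, x, hx⟩)
    · obtain ⟨hne, u, hu⟩ := exists_line_of_isPointOrLine hb
      have := hne.to_subtype
      obtain ⟨k₁, k₂, α, β, hk₁, hk₂, h, hβ⟩ := exists_isBalanced_of_line hB0' hu hd hx
      exact ⟨k₁, k₂, hk₁, hk₂, h.isGluing (.inr hβ)⟩
    · obtain ⟨hne, u, hu⟩ := exists_line_of_isPointOrLine hb
      have := hne.to_subtype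
      obtain ⟨k₁, k₂, α, β, hk₁, hk₂, h, hβ⟩ := exists_isBalanced_of_line hA0' hu hd hx
      exact ⟨k₂, k₁, hk₂, hk₁, h.symm.isGluing (.inl hβ)⟩
  · rintro k₁ k₂ hk₁ hk₂ ⟨α, β, h0, hI⟩
    obtain ⟨-, hα, hβ, -, -, hline⟩ := key hk₁ hk₂ h0 hI
    exact isCohenMacaulay_union_of_line hI (fun h => hα (degree_eq_zero hA0' h))
      (fun h => hβ (degree_eq_zero hB0' h)) hA hB hline
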